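/- Write $x\prec y$ for the strict coordinatewise order on $\{0,1\}^n$. A function $f:\{0,1\}^n\to\{0,1\}$ is *$k$-monotone* if there is no sequence $x_1\prec x_2\prec\dots\prec x_{k+1}$ in $\{0,1\}^n$ with $f(x_1)=1$ and $f(x_i)\neq f(x_{i+1})$ for all $1\le i\le k$; let $\mathcal M_k$ be the set of $k$-monotone functions. For real $t\ge 0$, *$t$-monotone* means $\lfloor t\rfloor$-monotone. Let $d(f,g)=2^{-n}\,|\{x: f(x)\ne g(x)\}|$ and $d(f,\mathcal M_\ell)=\min_{g\in\mathcal M_\ell} d(f,g)$. A *non-adaptive $q$-query algorithm* draws its internal randomness, chooses from the randomness alone a set of at most $q$ points of $\{0,1\}^n$, reads the values of the unknown function $f$ at these points, and outputs ACCEPT or REJECT depending on the randomness and these values. It is a *one-sided $(k,\ell)$-tester with proximity parameter $\varepsilon$* if it accepts every $f\in\mathcal M_k$ with probability $1$, and rejects every $f$ with $d(f,\mathcal M_\ell)>\varepsilon$ with probability at least $2/3$. **Theorem.** There are absolute constants $\varepsilon_0>0$, $c>0$ and $n_0$ such that for every $n\ge n_0$, every $0<\varepsilon\le\varepsilon_0$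 and every $q$, every non-adaptive $q$-query algorithm that is a one-sided $(2,n^{0.01})$-tester on $\{0,1\}^n$ with proximity parameter $\varepsilon$ satisfies $$q\ \ge\ \exp\!\left(c\,n^{0.48}\right).$$ -/

import Mathlib

open MeasureTheory

/-- The Boolean hypercube `{0,1}^n` (`false` is `0`, `true` is `1`), with the coordinatewise order. -/
abbrev Cube (n : ℕ) : Type := Fin n → Bool

/-- Boolean functions on the hypercube. -/
abbrev BoolFun (n : ℕ) : Type := Cube n → Bool

/-- A violation of `k`-monotonicity: a strictly increasing sequence of `k + 1` points
on which `f` starts at `1` and changes value at each of the `k` steps. -/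
def IsViolation {n : ℕ} (k : ℕ) (f : BoolFun n) (x : Fin (k + 1) → Cube n) : Prop :=
  StrictMono x ∧ f (x 0) = true ∧ ∀ i : Fin k, f (x i.castSucc) ≠ f (x i.succ)

/-- The set of `k`-monotone functions. -/
def kMonotone (n k : ℕ) : Set (BoolFun n) :=
  {f | ¬ ∃ x : Fin (k + 1) → Cube n, IsViolation k f x}

/-- Normalized Hamming distance between two Boolean functions. -/
noncomputable def relDist {n : ℕ} (f g : BoolFun n) : ℝ :=
  (hammingDist f g : ℝ) / 2 ^ n

/-- Distance of `f` to a property: the minimum of `relDist f g` over the members `g`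
(the infimum is attained for every nonempty property, see `isLeast_distTo`). -/
noncomputable def distTo {n : ℕ} (f : BoolFun n) (S : Set (BoolFun n)) : ℝ :=
  sInf (relDist f '' S)

theorem kMonotone_nonempty (n k : ℕ) : (kMonotone n k).Nonempty :=
  ⟨fun _ => false, fun ⟨_, _, h, _⟩ => Bool.false_ne_true h⟩

theorem isLeast_distTo {n : ℕ} (f : BoolFun n) {S : Set (BoolFun n)} (hS : S.Nonempty) :
    IsLeast (relDist f '' S) (distTo f S) :=
  ⟨(hS.image _).csInf_mem (Set.toFinite _), fun _ ha => csInf_le (Set.toFinite _).bddBelow ha⟩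

/-- A randomized non-adaptive algorithm with query access to a function on `{0,1}^n`.
The internal randomness is a seed `ω` drawn from an arbitrary probability space. The set of queried
points depends on the seed only; the output (`true` for ACCEPT, `false` for REJECT) depends
on the seed and on the values of the function at the queried points. -/
structure NonAdaptiveAlg (n : ℕ) where
  /-- the space of random seeds -/
  Seed : Type
  [measurableSpace : MeasurableSpace Seed]
  /-- the law of the seed -/
  P : Measure Seed
  [isProbabilityMeasure : IsProbabilityMeasure P]
  /-- the points queried -/
  queries : Seed → Finset (Cube n)
  /-- the decision taken from the seed and the answers to the queries -/
  output : (ω : Seed) → ({x // x ∈ queries ω} → Bool) → Bool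
  /-- for each input function, acceptance is an event -/
  measurableSet_accept : ∀ f : BoolFun n,
    MeasurableSet {ω | output ω (fun x => f x.1) = true}

namespace NonAdaptiveAlg

attribute [instance] measurableSpace isProbabilityMeasure

variable {n : ℕ}

/-- The output on input function `f` with seed `ω`. -/
def run (T : NonAdaptiveAlg n) (f : BoolFun n) (ω : T.Seed) : Bool :=
  T.output ω (fun x => f x.1)

/-- The probability that the algorithm outputs ACCEPT on `f`. -/
noncomputable def acceptProb (T : NonAdaptiveAlg n) (f : BoolFun n) : ℝ :=
  T.P.real {ω | T.run f ω = true}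

/-- The probability that the algorithm outputs REJECT on `f`. -/
noncomputable def rejectProb (T : NonAdaptiveAlg n) (f : BoolFun n) : ℝ :=
  T.P.real {ω | T.run f ω = false}

/-- In the worst case over the randomness, at most `q` points are queried. -/
def MakesAtMost (T : NonAdaptiveAlg n) (q : ℕ) : Prop :=
  ∀ ω, (T.queries ω).card ≤ q

/-- `T` is a one-sided `(k, l)`-tester for monotonicity with proximity parameter `ε`:
it accepts every `k`-monotone function with probability `1`, and rejects with probability at least
`2/3` every function whose distance to the `l`-monotone functions exceeds `ε`. -/
structure IsOneSidedTester (T : NonAdaptiveAlg n) (k l : ℕ) (ε : ℝ) : Prop where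
  completeness : ∀ f : BoolFun n, f ∈ kMonotone n k → T.acceptProb f = 1
  soundness : ∀ f : BoolFun n, ε < distTo f (kMonotone n l) → 2 / 3 ≤ T.rejectProb f

end NonAdaptiveAlg

/-! ### Binomial coefficients near the centre -/

section Binomial

/-! A one-sided tester can reject only after seeing a certificate, and certificates can be hidden.
Choose a random set `S` of `2r` coordinates and let `hardFun` alternate in stripes of width `w` in
the weight on `S`, cut off to about `√n / 8` consecutive levels of the weight on the complement. The
argument compares two properties of this family.

Every member is far from `ℓ`-monotone. Fix the coordinates outside `S`. Along each maximal chain of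
the subcube on `S`, an `ℓ`-monotone function disagrees with the stripes on at least `w * ℓ / 2`
levels (`mul_le_two_mul_card_ne_stripe`). Since `r` is of order `(w * ℓ) ^ 2`, each level involved
carries a fraction of order `1 / (w * ℓ)` of the subcube, so averaging over chains gives a constant
fraction of errors (`four_pow_le_card_ne_stripe`). The cut-off costs only another constant factor
(`mul_two_pow_le_hammingDist_hardFun`).

Violations are hard to hit. A pattern 1, 0, 1 on `x < y < z` forces `z` to exceed `x` on at least
`w` coordinates of `S`, while the cut-off keeps the total number of rising coordinates below `√n`
(`HasDipBetween.card_risingCoords`). For fixed `x`, `z`, a random `S` meets these coordinates in at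
most about `w / 8` points on average, and in `w` points with probability at most `exp (-w)`
(`choose_mul_choose_le_exp_neg`). A union bound over pairs of queries gives `2 / 3 ≤ q ^ 2 * exp
(-w)`. The constraint on `w` is `w * ℓ ^ 2 ≲ √n`, which for `ℓ ≈ n ^ 0.01` gives the exponent `0.48
= 1/2 - 2 * 0.01`. -/

theorem sixteen_pow_le_mul_centralBinom_sq {s : ℕ} (hs : 1 ≤ s) :
    16 ^ s ≤ 4 * s * s.centralBinom ^ 2 := by
  induction s, hs using Nat.le_induction with
  | base => simp [Nat.centralBinom, Nat.choose]
  | succ s hs ih =>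
    have h := Nat.succ_mul_centralBinom_succ s
    set a := s.centralBinom
    set b := (s + 1).centralBinom
    have h2 : (s + 1) * (4 * (s + 1) * b ^ 2) = 16 * (2 * s + 1) ^ 2 * a ^ 2 := by
      calc _ = 4 * ((s + 1) * b) ^ 2 := by ring
        _ = _ := by rw [h]; ring
    refine le_of_mul_le_mul_left ?_ (Nat.succ_pos s)
    rw [h2]
    calc (s + 1) * 16 ^ (s + 1) = 16 * (s + 1) * 16 ^ s := by ring
      _ ≤ 16 * (s + 1) * (4 * s * a ^ 2) := Nat.mul_le_mul_left _ ih
      _ = 16 * (4 * s * (s + 1)) * a ^ 2 := by ring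
      _ ≤ _ := by gcongr; nlinarith

theorem four_pow_le_mul_centralBinom {s t : ℕ} (hs : 1 ≤ s) (h : s ≤ t ^ 2) :
    4 ^ s ≤ 2 * t * s.centralBinom := by
  refine (Nat.pow_le_pow_iff_left two_ne_zero).1 ?_
  calc (4 ^ s) ^ 2 = 16 ^ s := by rw [← pow_mul, mul_comm, pow_mul]; norm_num
    _ ≤ 4 * s * s.centralBinom ^ 2 := sixteen_pow_le_mul_centralBinom_sq hs
    _ ≤ 4 * t ^ 2 * s.centralBinom ^ 2 := by gcongr
    _ = _ := by ring

/-- The ratio of consecutive coefficients is `(s - i) / (s + i + 1)`, so step `i` loses at most a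
fraction `(2i + 1) / s` of the central one; these losses add up to `i ^ 2 / s`. -/
theorem sub_sq_mul_centralBinom_le (s i : ℕ) (hi : i ≤ s) :
    ((s : ℤ) - i ^ 2) * s.centralBinom ≤ s * (2 * s).choose (s + i) := by
  induction i with
  | zero => simp [Nat.centralBinom]
  | succ i ih =>
    have ih := ih (by omega)
    have h1 : (((2 * s).choose (s + i + 1) : ℕ) : ℤ) * (s + i + 1)
        = (2 * s).choose (s + i) * ((s : ℤ) - i) := by
      have h := Nat.choose_succ_right_eq (2 * s) (s + i)
      rw [show 2 * s - (s + i) = s - i by omega] at h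
      have := congrArg (Nat.cast : ℕ → ℤ) h
      push_cast [Nat.cast_sub (show i ≤ s by omega)] at this
      exact this
    have h2 : (((2 * s).choose (s + i) : ℕ) : ℤ) ≤ s.centralBinom := by
      exact_mod_cast Nat.choose_le_centralBinom _ _
    have h3 : 0 ≤ (((2 * s).choose (s + i + 1) : ℕ) : ℤ) := by positivity
    have h4 : 0 ≤ (((2 * s).choose (s + i) : ℕ) : ℤ) := by positivity
    rw [show s + (i + 1) = s + i + 1 by ring]
    push_cast
    generalize (((2 * s).choose (s + i + 1) : ℕ) : ℤ) = c at *
    generalize (((2 * s).choose (s + i) : ℕ) : ℤ) = d at *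
    have h5 : c ≤ d := by
      by_contra! hc
      nlinarith [mul_nonneg h4 (Int.natCast_nonneg i), mul_pos (sub_pos.2 hc)
        (show (0 : ℤ) < s + i + 1 by positivity)]
    nlinarith [mul_nonneg (sub_nonneg.2 h5) (show (0 : ℤ) ≤ i + 1 by positivity),
      mul_le_mul_of_nonneg_left h2 (show (0 : ℤ) ≤ 2 * i + 1 by positivity)]

theorem four_pow_le_mul_choose {s t i : ℕ} (hs : 1 ≤ s) (h : s ≤ t ^ 2) (hi : 2 * i ^ 2 ≤ s) :
    4 ^ s ≤ 4 * t * (2 * s).choose (s + i) := by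
  have h1 := sub_sq_mul_centralBinom_le s i (by nlinarith)
  have h2 : s.centralBinom ≤ 2 * (2 * s).choose (s + i) := by
    have h3 : (s : ℤ) * s.centralBinom ≤ s * (2 * (2 * s).choose (s + i)) := by
      have : (s : ℤ) ≤ 2 * ((s : ℤ) - i ^ 2) := by
        have : (2 * (i : ℤ) ^ 2) ≤ s := by exact_mod_cast hi
        linarith
      nlinarith [mul_le_mul_of_nonneg_right this (Int.natCast_nonneg s.centralBinom)]
    have h4 := le_of_mul_le_mul_left h3 (by exact_mod_cast hs)
    exact_mod_cast h4
  calc 4 ^ s ≤ 2 * t * s.centralBinom := four_pow_le_mul_centralBinom hs h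
    _ ≤ 2 * t * (2 * (2 * s).choose (s + i)) := by gcongr
    _ = _ := by ring

end Binomial

/-! ### Errors against a striped function on one chain -/

section Stripes

/-- The indicator of `ℓ` pairs of consecutive blocks of width `w`, starting at level `r`,
with value `1` on the first and `0` on the second block of each pair. -/
def stripe (r w ℓ a : ℕ) : Bool :=
  decide (r ≤ a ∧ a < r + 2 * w * ℓ ∧ (a - r) / w % 2 = 0)

/-- Each pair of blocks in `G` supplies a 1 followed by a 0. Concatenating them gives an alternation
with `2 * G.card` terms, of which `ℓ + 1` are forbidden. -/
theorem two_mul_card_le_of_no_alternation {ℓ w : ℕ} {u : ℕ → Bool}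
    (hu : ¬ ∃ p : Fin (ℓ + 1) → ℕ, StrictMono p ∧ (∀ i, p i < 2 * w * ℓ) ∧
      ∀ i, u (p i) = decide (i.1 % 2 = 0))
    {G : Finset ℕ} (hG : G ⊆ Finset.range ℓ)
    (h1 : ∀ t ∈ G, ∃ a < w, u (2 * w * t + a) = true)
    (h0 : ∀ t ∈ G, ∃ b < w, u (2 * w * t + w + b) = false) :
    2 * G.card ≤ ℓ := by
  by_contra! hlt
  apply hu
  choose! a ha1 ha2 using h1
  choose! b hb1 hb2 using h0
  let e := G.orderEmbOfFin rfl
  have hi : ∀ i : Fin (ℓ + 1), i.1 / 2 < G.card := fun i => by omega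
  have he : ∀ k, e k ∈ G := fun k => G.orderEmbOfFin_mem rfl k
  let p : Fin (ℓ + 1) → ℕ := fun i =>
    if i.1 % 2 = 0 then 2 * w * e ⟨i.1 / 2, hi i⟩ + a (e ⟨i.1 / 2, hi i⟩)
    else 2 * w * e ⟨i.1 / 2, hi i⟩ + w + b (e ⟨i.1 / 2, hi i⟩)
  refine ⟨p, Fin.strictMono_iff_lt_succ.2 fun i => ?_, fun i => ?_, fun i => ?_⟩
  · rcases Nat.mod_two_eq_zero_or_one i.1 with h | h
    · have h2 : (i.1 + 1) % 2 = 1 := by omega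
      have h3 : (⟨(i.1 + 1) / 2, hi i.succ⟩ : Fin G.card) = ⟨i.1 / 2, hi i.castSucc⟩ := by
        ext; simp; omega
      simp only [p, Fin.val_castSucc, Fin.val_succ, h, h2, if_true, one_ne_zero, if_false, h3]
      have := ha1 _ (he ⟨i.1 / 2, hi i.castSucc⟩)
      omega
    · have h2 : (i.1 + 1) % 2 = 0 := by omega
      have h3 : (⟨i.1 / 2, hi i.castSucc⟩ : Fin G.card) < ⟨(i.1 + 1) / 2, hi i.succ⟩ := by
        simp only [Fin.lt_def]; omega
      simp only [p, Fin.val_castSucc, Fin.val_succ, h, h2, if_true, one_ne_zero, if_false]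
      have h4 := e.strictMono h3
      have := hb1 _ (he ⟨i.1 / 2, hi i.castSucc⟩)
      have h5 := Nat.mul_le_mul_left (2 * w) (Nat.succ_le_of_lt h4)
      rw [Nat.succ_eq_add_one, mul_add] at h5
      omega
  · have h4 := Finset.mem_range.1 (hG (he ⟨i.1 / 2, hi i⟩))
    have := hb1 _ (he ⟨i.1 / 2, hi i⟩)
    have := ha1 _ (he ⟨i.1 / 2, hi i⟩)
    have h5 := Nat.mul_le_mul_left (2 * w) (Nat.succ_le_of_lt h4)
    rw [Nat.succ_eq_add_one, mul_add] at h5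
    simp only [p]
    split_ifs <;> omega
  · simp only [p]
    split_ifs with h
    · simpa [h] using ha2 _ (he _)
    · simpa [h] using hb2 _ (he _)

/-- At least half of the `ℓ` pairs of blocks fail to show a 1 and then a 0, and each failing pair
has one block that is wrong throughout. -/
theorem mul_le_two_mul_card_ne_stripe {ℓ w : ℕ} (hw : 0 < w) {u : ℕ → Bool}
    (hu : ¬ ∃ p : Fin (ℓ + 1) → ℕ, StrictMono p ∧ (∀ i, p i < 2 * w * ℓ) ∧
      ∀ i, u (p i) = decide (i.1 % 2 = 0)) :
    w * ℓ ≤ 2 * ((Finset.range (2 * w * ℓ)).filter fun k => stripe 0 w ℓ k ≠ u k).card := by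
  classical
  set D := (Finset.range (2 * w * ℓ)).filter fun k => stripe 0 w ℓ k ≠ u k with hD
  let Q : ℕ → Prop := fun t => (∃ a < w, u (2 * w * t + a) = true) ∧
    ∃ b < w, u (2 * w * t + w + b) = false
  have hgood := two_mul_card_le_of_no_alternation hu
    (G := (Finset.range ℓ).filter Q) (Finset.filter_subset _ _)
    (fun t ht => (Finset.mem_filter.1 ht).2.1) (fun t ht => (Finset.mem_filter.1 ht).2.2)
  have hsplit := Finset.card_filter_add_card_filter_not (s := Finset.range ℓ) Q
  rw [Finset.card_range] at hsplit
  have hmaps : ∀ k ∈ D, k / (2 * w) ∈ Finset.range ℓ := fun k hk => by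
    have := Finset.mem_range.1 (Finset.mem_filter.1 hk).1
    exact Finset.mem_range.2 ((Nat.div_lt_iff_lt_mul (by omega)).2 (by linarith))
  have hfib : ∀ t ∈ (Finset.range ℓ).filter (fun t => ¬ Q t),
      w ≤ (D.filter fun k => k / (2 * w) = t).card := by
    intro t ht
    obtain ⟨htl, hQ⟩ := Finset.mem_filter.1 ht
    have htl := Finset.mem_range.1 htl
    have h5 := Nat.mul_le_mul_left (2 * w) (Nat.succ_le_of_lt htl)
    rw [Nat.succ_eq_add_one, mul_add] at h5
    -- The wrong block is the second if `u` takes the value 1 on the first, and the first otherwise.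
    have key : ∃ c, c + w ≤ 2 * w ∧ ∀ a < w, stripe 0 w ℓ (2 * w * t + c + a) ≠
        u (2 * w * t + c + a) := by
      by_cases h : ∃ a < w, u (2 * w * t + a) = true
      · refine ⟨w, by omega, fun a ha => ?_⟩
        have h0 : u (2 * w * t + w + a) = true := by
          by_contra hne
          exact hQ ⟨h, a, ha, by simpa using hne⟩
        have : (2 * w * t + w + a) / w = 2 * t + 1 := by
          rw [show 2 * w * t + w + a = a + w * (2 * t + 1) by ring, Nat.add_mul_div_left _ _ hw,
            Nat.div_eq_of_lt ha]; omega
        rw [h0, stripe, Nat.sub_zero, this]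
        simp
      · refine ⟨0, by omega, fun a ha => ?_⟩
        push Not at h
        have : (2 * w * t + a) / w = 2 * t := by
          rw [show 2 * w * t + a = a + w * (2 * t) by ring, Nat.add_mul_div_left _ _ hw,
            Nat.div_eq_of_lt ha]; omega
        rw [add_zero, stripe, Nat.sub_zero, this]
        have h6 := h a ha
        simp only [ne_eq, Bool.not_eq_true] at h6
        rw [h6]
        simp; omega
    obtain ⟨c, hc, hne⟩ := key
    calc w = (Finset.range w).card := by simp
      _ ≤ _ := Finset.card_le_card_of_injOn (fun a => 2 * w * t + c + a) (fun a ha => ?_)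
        (fun a _ b _ hab => by simpa using hab)
    have ha : a < w := by simpa using ha
    simp only [Finset.coe_filter, Set.mem_ofPred_eq, hD, Finset.mem_filter, Finset.mem_range]
    refine ⟨⟨by omega, hne a ha⟩, ?_⟩
    rw [show 2 * w * t + c + a = (c + a) + (2 * w) * t by ring,
      Nat.add_mul_div_left _ _ (by omega), Nat.div_eq_of_lt (by omega), zero_add]
  have hsum : ((Finset.range ℓ).filter (fun t => ¬ Q t)).card * w ≤ D.card := by
    rw [Finset.card_eq_sum_card_fiberwise hmaps]
    refine le_trans ?_ (Finset.sum_le_sum_of_subset (Finset.filter_subset (fun t => ¬ Q t) _))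
    rw [← smul_eq_mul]
    exact Finset.card_nsmul_le_sum _ _ _ hfib
  nlinarith

end Stripes

/-! ### Averaging over maximal chains -/

section Chains

/-- Double counting as in the LYM inequality: a numbering is a maximal chain, and a set `s` lies on
a proportion `1 / (Fintype.card X).choose s.card` of them. -/
theorem mul_le_mul_card_of_forall_numbering {X : Type*} [Fintype X] [DecidableEq X]
    {D : Finset (Finset X)} {M A K : ℕ}
    (hM : ∀ f : Numbering X, M ≤ (D.filter fun s => f.IsPrefix s).card)
    (hA : ∀ s ∈ D, A ≤ K * (Fintype.card X).choose s.card) :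
    M * A ≤ K * D.card := by
  have h1 : Fintype.card (Numbering X) * M ≤ ∑ s ∈ D, (Numbering.prefixed s).card := by
    have := Finset.sum_card_bipartiteAbove_eq_sum_card_bipartiteBelow
      (s := (Finset.univ : Finset (Numbering X))) (t := D) (fun f s => f.IsPrefix s)
    simp only [Finset.bipartiteAbove, Finset.bipartiteBelow] at this
    change _ ≤ ∑ s ∈ D, (Finset.univ.filter fun f : Numbering X => f.IsPrefix s).card
    rw [← this, ← Finset.card_univ, ← smul_eq_mul]
    exact Finset.card_nsmul_le_sum _ _ _ fun f _ => hM f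
  rw [Fintype.card_numbering] at h1
  have h2 : ∀ s ∈ D, (Numbering.prefixed s).card * A ≤ K * (Fintype.card X).factorial := by
    intro s hs
    rw [Numbering.card_prefixed, ← Nat.choose_mul_factorial_mul_factorial s.card_le_univ]
    calc _ ≤ s.card.factorial * (Fintype.card X - s.card).factorial
          * (K * (Fintype.card X).choose s.card) := Nat.mul_le_mul_left _ (hA s hs)
      _ = _ := by ring
  refine le_of_mul_le_mul_left ?_ (Nat.factorial_pos (Fintype.card X))
  calc (Fintype.card X).factorial * (M * A) = (Fintype.card X).factorial * M * A := by ring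
    _ ≤ (∑ s ∈ D, (Numbering.prefixed s).card) * A := Nat.mul_le_mul_right _ h1
    _ = ∑ s ∈ D, (Numbering.prefixed s).card * A := Finset.sum_mul ..
    _ ≤ ∑ s ∈ D, K * (Fintype.card X).factorial := Finset.sum_le_sum h2
    _ = _ := by simp; ring

/-- The set of the first `k` elements in a numbering. -/
def Numbering.initial {X : Type*} [Fintype X] (f : Numbering X) (k : ℕ) : Finset X :=
  Finset.univ.filter fun x => (f x).1 < k

theorem Numbering.card_initial {X : Type*} [Fintype X] (f : Numbering X) {k : ℕ}
    (hk : k ≤ Fintype.card X) : (f.initial k).card = k := by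
  rw [Numbering.initial, ← Fintype.card_subtype]
  rw [Fintype.card_congr (f.subtypeEquiv (q := fun y => y.1 < k) (fun _ => Iff.rfl)),
    Fintype.card_subtype, Fin.card_filter_val_lt, min_eq_right hk]

theorem Numbering.isPrefix_initial {X : Type*} [Fintype X] (f : Numbering X) {k : ℕ}
    (hk : k ≤ Fintype.card X) : f.IsPrefix (f.initial k) := fun x => by
  rw [f.card_initial hk]; simp [Numbering.initial]

/-- A function on the subsets of a `2r`-set that does not alternate `ℓ` times along a chain
differs from the stripe function on a constant fraction of the subsets. -/
theorem four_pow_le_card_ne_stripe {X : Type*} [Fintype X] [DecidableEq X] {w ℓ r : ℕ}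
    (hw : 0 < w) (hℓ : 0 < ℓ) (hr : r = 8 * (w * ℓ) ^ 2) (hX : Fintype.card X = 2 * r)
    (g : Finset X → Bool)
    (hg : ¬ ∃ x : Fin (ℓ + 1) → Finset X, StrictMono x ∧ ∀ i, g (x i) = decide (i.1 % 2 = 0)) :
    4 ^ r ≤ 24 * (Finset.univ.filter fun s : Finset X =>
      (r ≤ s.card ∧ s.card < r + 2 * w * ℓ) ∧ stripe r w ℓ s.card ≠ g s).card := by
  set D := Finset.univ.filter fun s : Finset X =>
      (r ≤ s.card ∧ s.card < r + 2 * w * ℓ) ∧ stripe r w ℓ s.card ≠ g s with hD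
  have hwl : 0 < w * ℓ := Nat.mul_pos hw hℓ
  have hJ : 2 * w * ℓ ≤ r := by rw [hr]; nlinarith
  have key : (w * ℓ) * 4 ^ r ≤ (2 * (4 * (3 * (w * ℓ)))) * D.card := by
    -- The size of `r` enters here: levels `r + i` with `i ≤ 2 * (w * ℓ)` satisfy `2 * i ^ 2 ≤ r`,
    -- and `r ≤ (3 * (w * ℓ)) ^ 2`.
    have hA : ∀ s ∈ D, 4 ^ r ≤ (4 * (3 * (w * ℓ))) * (Fintype.card X).choose s.card := by
      intro s hs
      obtain ⟨⟨h1, h2⟩, -⟩ := (Finset.mem_filter.1 hs).2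
      obtain ⟨i, hi⟩ := Nat.exists_eq_add_of_le h1
      rw [hX, hi]
      refine four_pow_le_mul_choose (by rw [hr]; nlinarith) (by rw [hr]; nlinarith) ?_
      have : i ≤ 2 * (w * ℓ) := by rw [← mul_assoc]; omega
      calc 2 * i ^ 2 ≤ 2 * (2 * (w * ℓ)) ^ 2 := by gcongr
        _ = 8 * (w * ℓ) ^ 2 := by ring
        _ = r := hr.symm
    have hM : ∀ f : Numbering X, w * ℓ ≤ 2 * (D.filter fun s => f.IsPrefix s).card := by
      intro f
      have hlt : ∀ k < 2 * w * ℓ, r + k ≤ Fintype.card X := fun k hk => by omega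
      have h1 := mul_le_two_mul_card_ne_stripe hw (ℓ := ℓ) (u := fun k => g (f.initial (r + k)))
        (by
          rintro ⟨p, hp, hp1, hp2⟩
          refine hg ⟨fun i => f.initial (r + p i), fun i j hij => ?_, hp2⟩
          refine Finset.ssubset_iff_subset_ne.2 ⟨fun x hx => ?_, fun h => ?_⟩
          · have := hp hij
            simp only [Numbering.initial, Finset.mem_filter, Finset.mem_univ, true_and] at hx ⊢
            omega
          · have h2 := congrArg Finset.card h
            rw [f.card_initial (hlt _ (hp1 i)), f.card_initial (hlt _ (hp1 j))] at h2
            have := hp hij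
            omega)
      refine h1.trans (Nat.mul_le_mul_left _ ?_)
      refine Finset.card_le_card_of_injOn (fun k => f.initial (r + k)) (fun k hk => ?_) ?_
      · obtain ⟨hk1, hk2⟩ := Finset.mem_filter.1 hk
        have hk1 := Finset.mem_range.1 hk1
        have hc := f.card_initial (hlt k hk1)
        refine Finset.mem_filter.2 ⟨Finset.mem_filter.2 ⟨Finset.mem_univ _, ?_⟩,
          f.isPrefix_initial (hlt k hk1)⟩
        rw [hc]
        refine ⟨⟨by omega, by omega⟩, ?_⟩
        convert hk2 using 1
        simp [stripe]
      · intro a ha b hb hab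
        have ha := Finset.mem_range.1 (Finset.mem_filter.1 ha).1
        have hb := Finset.mem_range.1 (Finset.mem_filter.1 hb).1
        have h2 := congrArg Finset.card hab
        simp only [f.card_initial (hlt _ ha), f.card_initial (hlt _ hb)] at h2
        omega
    -- Half of `w * ℓ` is rounded up, so that it is still a lower bound for the integer error count
    -- and nothing is lost on doubling.
    have h := mul_le_mul_card_of_forall_numbering (M := (w * ℓ + 1) / 2)
      (A := 4 ^ r) (fun f => by have := hM f; omega) hA
    have h3 : w * ℓ ≤ 2 * ((w * ℓ + 1) / 2) := by omega
    calc (w * ℓ) * 4 ^ r ≤ 2 * ((w * ℓ + 1) / 2) * 4 ^ r := Nat.mul_le_mul_right _ h3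
      _ = 2 * ((w * ℓ + 1) / 2 * 4 ^ r) := by ring
      _ ≤ 2 * ((4 * (3 * (w * ℓ))) * D.card) := Nat.mul_le_mul_left _ h
      _ = _ := by ring
  refine le_of_mul_le_mul_left ?_ hwl
  calc _ ≤ _ := key
    _ = _ := by ring

end Chains

/-! ### One-sided testers must see a violation -/

section Tester

variable {n : ℕ}

/-- A violation of `2`-monotonicity of `f` with lowest point `x` and highest point `z`. -/
def HasDipBetween (f : BoolFun n) (x z : Cube n) : Prop :=
  ∃ y, x < y ∧ y < z ∧ f x = true ∧ f y = false ∧ f z = true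

/-- The extension is the indicator of the order-convex hull of the queried ones; convexity excludes
the pattern 1, 0, 1. -/
theorem exists_kMonotone_two_extension (f : BoolFun n) (Q : Finset (Cube n))
    (h : ∀ x ∈ Q, ∀ z ∈ Q, ¬ HasDipBetween f x z) :
    ∃ g ∈ kMonotone n 2, ∀ x ∈ Q, g x = f x := by
  classical
  refine ⟨fun x => decide ((∃ u ∈ Q, f u = true ∧ u ≤ x) ∧ ∃ v ∈ Q, f v = true ∧ x ≤ v), ?_, ?_⟩
  · rintro ⟨x, hx, h0, hne⟩
    have h01 := hne 0
    have h12 := hne 1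
    simp only [Fin.castSucc_zero, Fin.succ_zero_eq_one, h0] at h01
    have h1 := (Bool.eq_false_iff.2 (Ne.symm h01))
    have h2 : _ = true := Bool.eq_true_of_not_eq_false (fun h => h12 (h1.trans h.symm))
    simp only [decide_eq_true_eq] at h0 h2
    obtain ⟨⟨u, hu, hfu, hux⟩, -⟩ := h0
    obtain ⟨-, v, hv, hfv, hxv⟩ := h2
    refine of_decide_eq_false h1 ⟨⟨u, hu, hfu, hux.trans ?_⟩, ⟨v, hv, hfv, le_trans ?_ hxv⟩⟩
    · exact hx.monotone (Fin.zero_le _)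
    · exact hx.monotone (by decide)
  · intro x hx
    cases hf : f x with
    | true => simpa using ⟨⟨x, hx, hf, le_rfl⟩, x, hx, hf, le_rfl⟩
    | false =>
      refine decide_eq_false ?_
      rintro ⟨⟨u, hu, hfu, hux⟩, v, hv, hfv, hxv⟩
      refine h u hu v hv ⟨x, lt_of_le_of_ne hux ?_, lt_of_le_of_ne hxv ?_, hfu, hf, hfv⟩
      · rintro rfl; simp [hf] at hfu
      · rintro rfl; simp [hf] at hfv

namespace NonAdaptiveAlg

theorem measurableSet_reject (T : NonAdaptiveAlg n) (f : BoolFun n) :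
    MeasurableSet {ω | T.run f ω = false} := by
  have : {ω | T.run f ω = false} = {ω | T.run f ω = true}ᶜ := by ext; simp
  rw [this]
  exact (T.measurableSet_accept f).compl

/-- A tester with one-sided error almost surely rejects only if it has seen a violation. -/
theorem ae_exists_dip_of_reject {T : NonAdaptiveAlg n}
    (hT : ∀ f ∈ kMonotone n 2, T.acceptProb f = 1) :
    ∀ᵐ ω ∂T.P, ∀ f, T.run f ω = false →
      ∃ x ∈ T.queries ω, ∃ z ∈ T.queries ω, HasDipBetween f x z := by
  -- There are finitely many `g`, so a single null set serves all of them.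
  have h : ∀ᵐ ω ∂T.P, ∀ g : BoolFun n, g ∈ kMonotone n 2 → T.run g ω = true := by
    rw [ae_all_iff]
    intro g
    by_cases hg : g ∈ kMonotone n 2
    · have h1 := hT g hg
      have h2 : T.P {ω | T.run g ω = true} = 1 := by
        rw [acceptProb, Measure.real] at h1
        rw [← ENNReal.ofReal_toReal (measure_ne_top T.P _), h1, ENNReal.ofReal_one]
      have h3 := (mem_ae_iff_prob_eq_one (T.measurableSet_accept g)).2 h2
      filter_upwards [h3] with ω hω _ using hω
    · exact Filter.Eventually.of_forall fun ω h => absurd h hg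
  filter_upwards [h] with ω hω f hf
  by_contra! hno
  obtain ⟨g, hg, hgf⟩ := exists_kMonotone_two_extension f (T.queries ω) hno
  have h1 := hω g hg
  have h2 : T.run g ω = T.run f ω := by
    unfold run
    congr 1
    ext x
    exact hgf x.1 x.2
  rw [h2, hf] at h1
  exact Bool.false_ne_true h1

/-- For almost every seed, each rejected `f i` has a dip between one of the at most `q ^ 2` pairs of
queries, and each pair serves at most `B` indices. -/
theorem sum_rejectProb_le {T : NonAdaptiveAlg n} {q B : ℕ} (hq : T.MakesAtMost q)
    (hT : ∀ f ∈ kMonotone n 2, T.acceptProb f = 1) {ι : Type*} (I : Finset ι)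
    (f : ι → BoolFun n)
    (hB : ∀ x z : Cube n, ∀ J ⊆ I, (∀ i ∈ J, HasDipBetween (f i) x z) → J.card ≤ B) :
    ∑ i ∈ I, T.rejectProb (f i) ≤ (q : ℝ) ^ 2 * B := by
  classical
  have h1 : ∀ i, T.rejectProb (f i)
      = ∫ ω, Set.indicator {ω | T.run (f i) ω = false} (fun _ => (1 : ℝ)) ω ∂T.P := fun i => by
    rw [integral_indicator_const _ (T.measurableSet_reject (f i))]
    simp [rejectProb]
  have hint : ∀ i ∈ I, Integrable
      (Set.indicator {ω | T.run (f i) ω = false} (fun _ => (1 : ℝ))) T.P := fun i _ =>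
    (integrable_const 1).indicator (T.measurableSet_reject (f i))
  simp_rw [h1]
  rw [← integral_finsetSum _ hint]
  have hle : ∀ᵐ ω ∂T.P, ∑ i ∈ I, Set.indicator {ω | T.run (f i) ω = false}
      (fun _ => (1 : ℝ)) ω ≤ (q : ℝ) ^ 2 * B := by
    filter_upwards [ae_exists_dip_of_reject hT] with ω hω
    have hcard : (I.filter fun i => T.run (f i) ω = false).card ≤ q ^ 2 * B := by
      have hsub : (I.filter fun i => T.run (f i) ω = false) ⊆
          (T.queries ω ×ˢ T.queries ω).biUnion
            fun p => I.filter fun i => HasDipBetween (f i) p.1 p.2 := by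
        intro i hi
        obtain ⟨hiI, hi⟩ := Finset.mem_filter.1 hi
        obtain ⟨x, hx, z, hz, hd⟩ := hω (f i) hi
        exact Finset.mem_biUnion.2 ⟨(x, z), Finset.mem_product.2 ⟨hx, hz⟩,
          Finset.mem_filter.2 ⟨hiI, hd⟩⟩
      refine (Finset.card_le_card hsub).trans
        ((Finset.card_biUnion_le_card_mul _ _ B fun p _ => ?_).trans ?_)
      · exact hB p.1 p.2 _ (Finset.filter_subset _ _) fun i hi => (Finset.mem_filter.1 hi).2
      · rw [Finset.card_product, sq]
        exact Nat.mul_le_mul_right _ (Nat.mul_le_mul (hq ω) (hq ω))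
    calc _ = ((I.filter fun i => T.run (f i) ω = false).card : ℝ) := by
          simp [Set.indicator_apply]
      _ ≤ _ := by exact_mod_cast hcard
  calc _ ≤ ∫ _, (q : ℝ) ^ 2 * B ∂T.P :=
        integral_mono_ae (integrable_finsetSum _ hint) (integrable_const _) hle
    _ = _ := by simp

end NonAdaptiveAlg

end Tester

/-! ### The hard family: locality of dips and distance -/

section HardFunction

variable {n : ℕ}

/-- The number of coordinates in `S` equal to `1`. -/
def weightOn (S : Finset (Fin n)) (x : Cube n) : ℕ :=
  (S.filter fun i => x i = true).card

/-- The function alternating in stripes of width `w` of the weight on `S`, restricted to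
`j` levels of the weight on the complement of `S`. -/
def hardFun (S : Finset (Fin n)) (r w ℓ s j : ℕ) : BoolFun n := fun x =>
  decide (s ≤ weightOn Sᶜ x ∧ weightOn Sᶜ x < s + j) && stripe r w ℓ (weightOn S x)

/-- The coordinates on which `x` is `0` and `z` is `1`. -/
def risingCoords (x z : Cube n) : Finset (Fin n) :=
  Finset.univ.filter fun i => x i = false ∧ z i = true

theorem weightOn_mono (S : Finset (Fin n)) : Monotone (weightOn S) := fun x y h => by
  refine Finset.card_le_card fun i hi => ?_
  obtain ⟨h1, h2⟩ := Finset.mem_filter.1 hi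
  exact Finset.mem_filter.2 ⟨h1, Bool.le_iff_imp.1 (h i) h2⟩

theorem weightOn_add_card_risingCoords (S : Finset (Fin n)) {x z : Cube n} (h : x ≤ z) :
    weightOn S x + (risingCoords x z ∩ S).card = weightOn S z := by
  classical
  rw [weightOn, weightOn, ← Finset.card_union_of_disjoint]
  · congr 1
    ext i
    have := Bool.le_iff_imp.1 (h i)
    simp only [risingCoords, Finset.mem_union, Finset.mem_filter, Finset.mem_inter,
      Finset.mem_univ, true_and]
    cases hx : x i <;> simp_all [and_comm]
  · rw [Finset.disjoint_left]
    intro i hi hi'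
    simp only [risingCoords, Finset.mem_filter, Finset.mem_inter,
      Finset.mem_univ, true_and] at hi hi'
    simp_all

/-- The weights of `y` lie between those of `x` and `z`, so `f y = false` can only come from an odd
block; the block index therefore rises twice. The upper bound holds because `x` and `z` both lie in
the window of `2 * w * ℓ` by `j` levels. -/
theorem HasDipBetween.card_risingCoords {S : Finset (Fin n)} {r w ℓ s j : ℕ} (hw : 0 < w)
    {x z : Cube n} (h : HasDipBetween (hardFun S r w ℓ s j) x z) :
    w ≤ (risingCoords x z ∩ S).card ∧ (risingCoords x z).card ≤ 2 * w * ℓ + j := by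
  obtain ⟨y, hxy, hyz, hx, hy, hz⟩ := h
  have h1 := weightOn_mono S hxy.le
  have h2 := weightOn_mono S hyz.le
  have h3 := weightOn_mono Sᶜ hxy.le
  have h4 := weightOn_mono Sᶜ hyz.le
  have h5 := weightOn_add_card_risingCoords S (hxy.trans hyz).le
  have h6 := weightOn_add_card_risingCoords Sᶜ (hxy.trans hyz).le
  have h7 : (risingCoords x z ∩ S).card + (risingCoords x z ∩ Sᶜ).card
      = (risingCoords x z).card := by
    rw [← Finset.sdiff_eq_inter_compl]
    exact Finset.card_inter_add_card_sdiff _ _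
  simp only [hardFun, stripe, Bool.and_eq_true, decide_eq_true_eq] at hx hz
  obtain ⟨⟨hx1, hx2⟩, hx3, hx4, hx5⟩ := hx
  obtain ⟨⟨hz1, hz2⟩, hz3, hz4, hz5⟩ := hz
  simp only [hardFun, stripe, Bool.and_eq_false_iff, decide_eq_false_iff_not] at hy
  have hy5 : ¬ (weightOn S y - r) / w % 2 = 0 := by
    rcases hy with hy | hy
    · exact absurd ⟨by omega, by omega⟩ hy
    · exact fun h => hy ⟨by omega, by omega, h⟩
  refine ⟨?_, by omega⟩
  have h8 : (weightOn S x - r) / w ≤ (weightOn S y - r) / w := Nat.div_le_div_right (by omega)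
  have h9 : (weightOn S y - r) / w ≤ (weightOn S z - r) / w := Nat.div_le_div_right (by omega)
  have h10 : (weightOn S x - r) / w + 1 ≤ (weightOn S y - r) / w := by
    rcases h8.eq_or_lt with h | h
    · rw [← h] at hy5; exact absurd hx5 hy5
    · exact h
  have h11 : (weightOn S y - r) / w + 1 ≤ (weightOn S z - r) / w := by
    rcases h9.eq_or_lt with h | h
    · rw [h] at hy5; exact absurd hz5 hy5
    · exact h
  by_contra! hlt
  have h12 : (weightOn S z - r) / w ≤ (weightOn S x - r + w) / w :=
    Nat.div_le_div_right (by omega)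
  rw [Nat.add_div_right _ hw] at h12
  omega

/-- The point with the set of ones `A` inside and `B` outside of `S`. -/
def gluePoint (S : Finset (Fin n)) (A : Finset {i // i ∈ S}) (B : Finset {i // i ∉ S}) : Cube n :=
  fun i => if h : i ∈ S then decide (⟨i, h⟩ ∈ A) else decide (⟨i, h⟩ ∈ B)

theorem gluePoint_inside (S : Finset (Fin n)) (A : Finset {i // i ∈ S})
    (B : Finset {i // i ∉ S}) (i : {i // i ∈ S}) :
    gluePoint S A B i.1 = decide (i ∈ A) := by
  simp [gluePoint, i.2]

theorem gluePoint_outside (S : Finset (Fin n)) (A : Finset {i // i ∈ S})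
    (B : Finset {i // i ∉ S}) (i : {i // i ∉ S}) :
    gluePoint S A B i.1 = decide (i ∈ B) := by
  simp [gluePoint, i.2]

theorem weightOn_gluePoint (S : Finset (Fin n)) (A : Finset {i // i ∈ S})
    (B : Finset {i // i ∉ S}) : weightOn S (gluePoint S A B) = A.card := by
  rw [weightOn, ← Finset.card_map (Function.Embedding.subtype _)]
  congr 1
  ext i
  rw [Finset.mem_filter, Finset.mem_map]
  constructor
  · rintro ⟨h, h'⟩
    exact ⟨⟨i, h⟩, of_decide_eq_true ((gluePoint_inside S A B ⟨i, h⟩).symm.trans h'), rfl⟩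
  · rintro ⟨a, ha, rfl⟩
    exact ⟨a.2, (gluePoint_inside S A B a).trans (decide_eq_true ha)⟩

theorem weightOn_compl_gluePoint (S : Finset (Fin n)) (A : Finset {i // i ∈ S})
    (B : Finset {i // i ∉ S}) : weightOn Sᶜ (gluePoint S A B) = B.card := by
  rw [weightOn, ← Finset.card_map (Function.Embedding.subtype _)]
  congr 1
  ext i
  rw [Finset.mem_filter, Finset.mem_map]
  constructor
  · rintro ⟨h, h'⟩
    exact ⟨⟨i, Finset.mem_compl.1 h⟩, of_decide_eq_true ((gluePoint_outside S A B ⟨i, Finset.mem_compl.1 h⟩).symm.trans h'), rfl⟩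
  · rintro ⟨a, ha, rfl⟩
    exact ⟨Finset.mem_compl.2 a.2, (gluePoint_outside S A B a).trans (decide_eq_true ha)⟩

theorem gluePoint_injective (S : Finset (Fin n)) {A A' : Finset {i // i ∈ S}}
    {B B' : Finset {i // i ∉ S}} (h : gluePoint S A B = gluePoint S A' B') :
    A = A' ∧ B = B' := by
  constructor
  · ext i
    have := congrFun h i.1
    rw [gluePoint_inside, gluePoint_inside] at this
    simpa using this
  · ext i
    have := congrFun h i.1
    rw [gluePoint_outside, gluePoint_outside] at this
    simpa using this

theorem strictMono_gluePoint (S : Finset (Fin n)) (B : Finset {i // i ∉ S}) :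
    StrictMono fun A => gluePoint S A B := by
  refine Monotone.strictMono_of_injective (fun A A' h i => ?_)
    (fun A A' h => (gluePoint_injective S h).1)
  by_cases hi : i ∈ S
  · simp only [gluePoint, hi, dite_true]
    exact Bool.le_iff_imp.2 fun h' => decide_eq_true (h (of_decide_eq_true h'))
  · simp [gluePoint, hi]

theorem not_exists_alternation {ℓ : ℕ} {g : BoolFun n} (hg : g ∈ kMonotone n ℓ)
    (S : Finset (Fin n)) (B : Finset {i // i ∉ S}) :
    ¬ ∃ x : Fin (ℓ + 1) → Finset {i // i ∈ S}, StrictMono x ∧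
      ∀ i, g (gluePoint S (x i) B) = decide (i.1 % 2 = 0) := by
  rintro ⟨x, hx, hxg⟩
  refine hg ⟨fun i => gluePoint S (x i) B, (strictMono_gluePoint S B).comp hx, ?_, fun i => ?_⟩
  · simp [hxg]
  · simp only [hxg, Fin.val_castSucc, Fin.val_succ, ne_eq, decide_eq_decide]
    omega

/-- Each of the `j` levels has at least a fraction `1 / (8 * t)` of all subsets; rounding to `2 * s`
elements accounts for one factor 2. -/
theorem mul_two_pow_le_card_levels {Y : Type*} [Fintype Y] {s t j : ℕ}
    (hs : s = Fintype.card Y / 2) (hs1 : 1 ≤ s) (hst : s ≤ t ^ 2) (hj : 2 * j ^ 2 ≤ s) :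
    j * 2 ^ Fintype.card Y ≤ 8 * t *
      (Finset.univ.filter fun B : Finset Y => s ≤ B.card ∧ B.card < s + j).card := by
  classical
  have hmaps : ∀ B ∈ Finset.univ.filter (fun B : Finset Y => s ≤ B.card ∧ B.card < s + j),
      B.card ∈ Finset.Ico s (s + j) := fun B hB =>
    Finset.mem_Ico.2 (Finset.mem_filter.1 hB).2
  rw [Finset.card_eq_sum_card_fiberwise hmaps, Finset.mul_sum]
  calc j * 2 ^ Fintype.card Y = (Finset.Ico s (s + j)).card • 2 ^ Fintype.card Y := by simp
    _ ≤ _ := Finset.card_nsmul_le_sum _ _ _ fun k hk => ?_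
  obtain ⟨hk1, hk2⟩ := Finset.mem_Ico.1 hk
  obtain ⟨i, rfl⟩ := Nat.exists_eq_add_of_le hk1
  have hfib : (Finset.univ : Finset Y).powersetCard (s + i) ⊆
      ((Finset.univ.filter (fun B : Finset Y => s ≤ B.card ∧ B.card < s + j)).filter
        fun B => B.card = s + i) := by
    intro B hB
    have := (Finset.mem_powersetCard.1 hB).2
    simp only [Finset.mem_filter, Finset.mem_univ, true_and]
    omega
  have h1 := Finset.card_le_card hfib
  rw [Finset.card_powersetCard, Finset.card_univ] at h1
  have h2 : 4 ^ s ≤ 4 * t * (2 * s).choose (s + i) := four_pow_le_mul_choose hs1 hst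
    (le_trans (by gcongr; omega) hj)
  have h3 : (2 * s).choose (s + i) ≤ (Fintype.card Y).choose (s + i) :=
    Nat.choose_le_choose _ (by omega)
  calc 2 ^ Fintype.card Y ≤ 2 ^ (2 * s + 1) := Nat.pow_le_pow_right (by norm_num) (by omega)
    _ = 2 * 4 ^ s := by rw [pow_succ, pow_mul]; norm_num [mul_comm]
    _ ≤ 2 * (4 * t * (Fintype.card Y).choose (s + i)) :=
      Nat.mul_le_mul_left _ (h2.trans (Nat.mul_le_mul_left _ h3))
    _ = 8 * t * (Fintype.card Y).choose (s + i) := by ring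
    _ ≤ _ := Nat.mul_le_mul_left _ h1

/-- The hard function is far from every `ℓ`-monotone function. -/
theorem mul_two_pow_le_hammingDist_hardFun {S : Finset (Fin n)} {r w ℓ s t j : ℕ}
    (hw : 0 < w) (hℓ : 0 < ℓ) (hr : r = 8 * (w * ℓ) ^ 2) (hS : S.card = 2 * r)
    (hs : s = (n - 2 * r) / 2) (hs1 : 1 ≤ s) (hst : s ≤ t ^ 2) (hj : 2 * j ^ 2 ≤ s)
    {g : BoolFun n} (hg : g ∈ kMonotone n ℓ) :
    j * 2 ^ n ≤ 192 * t * hammingDist (hardFun S r w ℓ s j) g := by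
  classical
  have hX : Fintype.card {i // i ∈ S} = 2 * r := by simpa using hS
  have hn : 2 * r ≤ n := by simpa [hS] using S.card_le_univ
  have hY : Fintype.card {i // i ∉ S} = n - 2 * r := by
    rw [Fintype.card_subtype_compl, hX, Fintype.card_fin]
  set W := Finset.univ.filter fun B : Finset {i // i ∉ S} => s ≤ B.card ∧ B.card < s + j with hW
  have hWcard : j * 2 ^ (n - 2 * r) ≤ 8 * t * W.card := by
    have := mul_two_pow_le_card_levels (Y := {i // i ∉ S}) (by rw [hY, hs]) hs1 hst hj
    rwa [hY] at this
  let E : Finset {i // i ∉ S} → Finset (Finset {i // i ∈ S}) := fun B =>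
    Finset.univ.filter fun A => (r ≤ A.card ∧ A.card < r + 2 * w * ℓ) ∧
      stripe r w ℓ A.card ≠ g (gluePoint S A B)
  have hE : ∀ B ∈ W, 4 ^ r ≤ 24 * (E B).card := fun B _ =>
    four_pow_le_card_ne_stripe hw hℓ hr hX _ (not_exists_alternation hg S B)
  have hdist : (W.sigma E).card ≤ hammingDist (hardFun S r w ℓ s j) g := by
    refine Finset.card_le_card_of_injOn (fun p => gluePoint S p.2 p.1) (fun p hp => ?_) ?_
    · obtain ⟨h1, h2⟩ := Finset.mem_sigma.1 hp
      have h1 := (Finset.mem_filter.1 h1).2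
      have h2 := (Finset.mem_filter.1 h2).2.2
      refine Finset.mem_filter.2 ⟨Finset.mem_univ _, ?_⟩
      simp only [hardFun, weightOn_gluePoint, weightOn_compl_gluePoint, h1, and_self,
        decide_true, Bool.true_and]
      exact h2
    · rintro ⟨B, A⟩ - ⟨B', A'⟩ - h
      obtain ⟨rfl, rfl⟩ := gluePoint_injective S h
      rfl
  rw [Finset.card_sigma] at hdist
  have hsum : W.card * 4 ^ r ≤ 24 * hammingDist (hardFun S r w ℓ s j) g := by
    calc W.card * 4 ^ r = W.card • 4 ^ r := rfl
      _ ≤ ∑ B ∈ W, 24 * (E B).card := Finset.card_nsmul_le_sum _ _ _ hE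
      _ = 24 * ∑ B ∈ W, (E B).card := (Finset.mul_sum ..).symm
      _ ≤ _ := Nat.mul_le_mul_left _ hdist
  have hpow : 2 ^ n = 2 ^ (n - 2 * r) * 4 ^ r := by
    rw [show (4 : ℕ) = 2 ^ 2 by norm_num, ← pow_mul, ← pow_add]; congr 1; omega
  calc j * 2 ^ n = j * 2 ^ (n - 2 * r) * 4 ^ r := by rw [hpow, mul_assoc]
    _ ≤ 8 * t * W.card * 4 ^ r := Nat.mul_le_mul_right _ hWcard
    _ = 8 * t * (W.card * 4 ^ r) := by ring
    _ ≤ 8 * t * (24 * hammingDist (hardFun S r w ℓ s j) g) := Nat.mul_le_mul_left _ hsum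
    _ = _ := by ring

end HardFunction

/-! ### Hypergeometric tail bound -/

section Tail

theorem pow_mul_choose_le {m n : ℕ} (h : m ≤ n) (w : ℕ) :
    n ^ w * m.choose w ≤ m ^ w * n.choose w := by
  have key : n ^ w * m.descFactorial w ≤ m ^ w * n.descFactorial w := by
    induction w with
    | zero => simp
    | succ w ih =>
      rw [Nat.descFactorial_succ, Nat.descFactorial_succ]
      have h1 : n * (m - w) ≤ m * (n - w) := by
        rw [Nat.mul_sub, Nat.mul_sub, mul_comm n m]
        exact Nat.sub_le_sub_left (Nat.mul_le_mul_right _ h) _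
      calc n ^ (w + 1) * ((m - w) * m.descFactorial w)
          = (n * (m - w)) * (n ^ w * m.descFactorial w) := by ring
        _ ≤ (m * (n - w)) * (m ^ w * n.descFactorial w) := Nat.mul_le_mul h1 ih
        _ = _ := by ring
  rw [Nat.descFactorial_eq_factorial_mul_choose, Nat.descFactorial_eq_factorial_mul_choose] at key
  refine le_of_mul_le_mul_left ?_ (Nat.factorial_pos w)
  calc _ = n ^ w * (w.factorial * m.choose w) := by ring
    _ ≤ _ := key
    _ = _ := by ring

/-- The number of `m`-sets meeting a set `D` in at least `w` points. -/
theorem card_le_choose_mul_choose {α : Type*} [Fintype α] [DecidableEq α] {m w : ℕ}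
    (hwm : w ≤ m) (D : Finset α) {J : Finset (Finset α)}
    (hJ : J ⊆ Finset.univ.powersetCard m) (hD : ∀ S ∈ J, w ≤ (D ∩ S).card) :
    J.card ≤ D.card.choose w * (Fintype.card α - w).choose (m - w) := by
  have hsub : J ⊆ (D.powersetCard w).biUnion
      fun U => (Finset.univ.powersetCard m).filter (U ⊆ ·) := by
    intro S hS
    obtain ⟨U, hU, hUc⟩ := Finset.exists_subset_card_eq (hD S hS)
    exact Finset.mem_biUnion.2 ⟨U, Finset.mem_powersetCard.2
      ⟨hU.trans Finset.inter_subset_left, hUc⟩,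
      Finset.mem_filter.2 ⟨hJ hS, hU.trans Finset.inter_subset_right⟩⟩
  refine (Finset.card_le_card hsub).trans ((Finset.card_biUnion_le_card_mul _ _
    ((Fintype.card α - w).choose (m - w)) fun U hU => ?_).trans ?_)
  · have hUc := (Finset.mem_powersetCard.1 hU).2
    rw [Finset.card_filter_powersetCard_subset _ _ _ (Finset.subset_univ _) (by omega), hUc,
      Finset.card_univ]
  · rw [Finset.card_powersetCard]

/-- After division by `n.choose m` this is the union bound `R.choose w * (m / n) ^ w ≤ (e * R * m /
(w * n)) ^ w`, and the hypothesis with `e ^ 2 ≤ 8` makes the base at most `1 / e`. -/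
theorem choose_mul_choose_le_exp_neg {n m R w : ℕ} (hw : 0 < w) (hwm : w ≤ m) (hmn : m ≤ n)
    (h : 8 * (R * m) ≤ w * n) :
    ((R.choose w * (n - w).choose (m - w) : ℕ) : ℝ) ≤ Real.exp (-w) * n.choose m := by
  have hw' : (0 : ℝ) < w := by exact_mod_cast hw
  have hn' : (0 : ℝ) < n := by exact_mod_cast (by omega : 0 < n)
  have hC : (0 : ℝ) < n.choose w := by exact_mod_cast Nat.choose_pos (by omega)
  have h1 : (R.choose w : ℝ) * w ^ w ≤ R ^ w * Real.exp w := by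
    have ha := Nat.choose_le_pow_div (α := ℝ) w R
    have hb := Real.pow_div_factorial_le_exp (x := (w : ℝ)) hw'.le w
    have hf : (0 : ℝ) < w.factorial := by exact_mod_cast Nat.factorial_pos w
    calc (R.choose w : ℝ) * w ^ w ≤ (R ^ w / w.factorial) * w ^ w := by gcongr
      _ = R ^ w * (w ^ w / w.factorial) := by ring
      _ ≤ _ := by gcongr
  have h2 : (n : ℝ) ^ w * m.choose w ≤ m ^ w * n.choose w := by
    exact_mod_cast pow_mul_choose_le hmn w
  have h3 : (n.choose m : ℝ) * m.choose w = n.choose w * (n - w).choose (m - w) := by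
    exact_mod_cast Nat.choose_mul hwm
  have hE : Real.exp (w : ℝ) = Real.exp 1 ^ w := by
    rw [← Real.exp_nat_mul, mul_one]
  have h4 : Real.exp 1 * Real.exp 1 * (R * m) ≤ (w : ℝ) * n := by
    have h5 : (8 * (R * m) : ℝ) ≤ w * n := by exact_mod_cast h
    have h6 : Real.exp 1 * Real.exp 1 ≤ 8 := by
      nlinarith [Real.exp_one_lt_d9, Real.exp_pos 1]
    nlinarith [mul_nonneg (Nat.cast_nonneg (α := ℝ) R) (Nat.cast_nonneg (α := ℝ) m)]
  have h7 : (R.choose w : ℝ) * m.choose w * Real.exp w ≤ n.choose w := by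
    refine le_of_mul_le_mul_left ?_ (show (0 : ℝ) < w ^ w * n ^ w by positivity)
    calc (w : ℝ) ^ w * n ^ w * (R.choose w * m.choose w * Real.exp w)
        = (R.choose w * w ^ w) * (n ^ w * m.choose w) * Real.exp w := by ring
      _ ≤ (R ^ w * Real.exp w) * (m ^ w * n.choose w) * Real.exp w := by gcongr
      _ = (Real.exp 1 * Real.exp 1 * (R * m)) ^ w * n.choose w := by
        rw [hE]; simp only [mul_pow]; ring
      _ ≤ (w * n) ^ w * n.choose w := by gcongr
      _ = _ := by rw [mul_pow]
  refine le_of_mul_le_mul_left ?_ (show (0 : ℝ) < n.choose w * Real.exp w by positivity)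
  push_cast
  calc (n.choose w : ℝ) * Real.exp w * (R.choose w * (n - w).choose (m - w))
      = R.choose w * Real.exp w * (n.choose w * (n - w).choose (m - w)) := by ring
    _ = (R.choose w * m.choose w * Real.exp w) * n.choose m := by rw [← h3]; ring
    _ ≤ n.choose w * n.choose m := by gcongr
    _ = _ := by rw [Real.exp_neg]; field_simp

end Tail

/-! ### Choice of parameters and conclusion -/

section LowerBound

/-- A lower bound on the number of queries of a one-sided tester, for integer parameters. -/
theorem exp_le_queries_of_isOneSidedTester {n ℓ R w : ℕ} (hn : 64 ≤ n) (hℓ : 0 < ℓ)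
    (hw : 0 < w) (hR : R = n.sqrt) (hwR : 128 * w * ℓ ^ 2 ≤ R) {ε : ℝ} (hε : ε ≤ 1 / 4000)
    {T : NonAdaptiveAlg n} {q : ℕ} (hq : T.MakesAtMost q) (hT : T.IsOneSidedTester 2 ℓ ε) :
    Real.exp (w / 4) ≤ q := by
  classical
  have hR1 : R * R ≤ n := by rw [hR]; exact Nat.sqrt_le n
  have hR2 : n < (R + 1) * (R + 1) := by rw [hR]; exact Nat.lt_succ_sqrt n
  have hR8 : 8 ≤ R := by by_contra! h; nlinarith
  obtain ⟨r, hr⟩ : ∃ r, r = 8 * (w * ℓ) ^ 2 := ⟨_, rfl⟩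
  obtain ⟨s, hs⟩ : ∃ s, s = (n - 2 * r) / 2 := ⟨_, rfl⟩
  -- Small enough that `2 * j ^ 2 ≤ s` and `2 * w * ℓ + j ≤ R`, yet of order `√n`, so that the
  -- window keeps a constant fraction of the cube.
  obtain ⟨j, hj⟩ : ∃ j, j = R / 8 := ⟨_, rfl⟩
  have hwl : w * ℓ ≤ w * ℓ ^ 2 := Nat.mul_le_mul_left _ (by nlinarith)
  have hwlR : 128 * (w * ℓ) ≤ R := by linarith
  have hrn : 2048 * r ≤ n := by
    rw [hr]
    calc 2048 * (8 * (w * ℓ) ^ 2) = (128 * (w * ℓ)) * (128 * (w * ℓ)) := by ring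
      _ ≤ R * R := Nat.mul_le_mul hwlR hwlR
      _ ≤ n := hR1
  have hs1 : 1 ≤ s := by omega
  have hst : s ≤ R ^ 2 := by
    have : 2 * s ≤ n := by omega
    nlinarith
  have hj2 : 2 * j ^ 2 ≤ s := by
    have h1 : 8 * j ≤ R := by omega
    have h2 : (8 * j) * (8 * j) ≤ n := (Nat.mul_le_mul h1 h1).trans hR1
    have h3 : 32 * (2 * j ^ 2) ≤ n := by linarith [sq j]
    omega
  have hw2r : w ≤ 2 * r := by
    have : 0 < w * ℓ := Nat.mul_pos hw hℓ
    rw [hr]; nlinarith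
  let I : Finset (Finset (Fin n)) := Finset.univ.powersetCard (2 * r)
  let f : Finset (Fin n) → BoolFun n := fun S => hardFun S r w ℓ s j
  have hfar : ∀ S ∈ I, 2 / 3 ≤ T.rejectProb (f S) := by
    intro S hS
    apply hT.soundness
    obtain ⟨g, hg, hgd⟩ := (isLeast_distTo (f S) (kMonotone_nonempty n ℓ)).1
    rw [← hgd]
    have h1 := mul_two_pow_le_hammingDist_hardFun hw hℓ hr (Finset.mem_powersetCard.1 hS).2
      hs hs1 hst hj2 hg
    have h2 : R ≤ 16 * j := by omega
    -- The relative distance is at least `1 / 3072`, with `3072 = 16 * 192`; this exceeds `1 /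
    -- 4000`.
    have h3 : 2 ^ n ≤ 3072 * hammingDist (f S) g := by
      refine le_of_mul_le_mul_left ?_ (show 0 < R by omega)
      calc R * 2 ^ n ≤ 16 * j * 2 ^ n := Nat.mul_le_mul_right _ h2
        _ = 16 * (j * 2 ^ n) := by ring
        _ ≤ 16 * (192 * R * hammingDist (f S) g) := Nat.mul_le_mul_left _ h1
        _ = _ := by ring
    have h4 : (2 : ℝ) ^ n ≤ 3072 * hammingDist (f S) g := by exact_mod_cast h3
    rw [relDist, lt_div_iff₀ (by positivity)]
    have h5 : (0 : ℝ) < 2 ^ n := by positivity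
    nlinarith
  have hB : ∀ x z : Cube n, ∀ J ⊆ I, (∀ S ∈ J, HasDipBetween (f S) x z) →
      J.card ≤ R.choose w * (n - w).choose (2 * r - w) := by
    intro x z J hJ hd
    rcases J.eq_empty_or_nonempty with rfl | ⟨S, hS⟩
    · simp
    have h1 := ((hd S hS).card_risingCoords hw).2
    have h2 := card_le_choose_mul_choose hw2r (risingCoords x z) hJ
      fun S hS => ((hd S hS).card_risingCoords hw).1
    rw [Fintype.card_fin] at h2
    refine h2.trans (Nat.mul_le_mul_right _ (Nat.choose_le_choose _ ?_))
    rw [mul_assoc] at h1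
    omega
  have hsum := NonAdaptiveAlg.sum_rejectProb_le hq hT.completeness I f hB
  have hI : (I.card : ℝ) = n.choose (2 * r) := by
    simp [I, Finset.card_powersetCard]
  have hlow : (I.card : ℝ) * (2 / 3) ≤ ∑ S ∈ I, T.rejectProb (f S) := by
    rw [← nsmul_eq_mul]
    exact Finset.card_nsmul_le_sum _ _ _ hfar
  have htail := choose_mul_choose_le_exp_neg (R := R) hw hw2r (show 2 * r ≤ n by omega) (by
    rw [hr]
    calc 8 * (R * (2 * (8 * (w * ℓ) ^ 2))) = w * (R * (128 * w * ℓ ^ 2)) := by ring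
      _ ≤ w * (R * R) := by gcongr
      _ ≤ w * n := by gcongr)
  have hpos : (0 : ℝ) < n.choose (2 * r) := by exact_mod_cast Nat.choose_pos (by omega)
  have h1 : 2 / 3 ≤ (q : ℝ) ^ 2 * Real.exp (-w) := by
    refine le_of_mul_le_mul_left ?_ hpos
    calc (n.choose (2 * r) : ℝ) * (2 / 3) ≤ _ := hI ▸ hlow
      _ ≤ _ := hsum
      _ ≤ (q : ℝ) ^ 2 * (Real.exp (-w) * n.choose (2 * r)) := by gcongr
      _ = _ := by ring
  have hw1 : (1 : ℝ) ≤ w := by exact_mod_cast hw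
  -- One factor `exp (w / 2)` absorbs the constant `2 / 3`; the other is the square of the claimed
  -- bound.
  have h2 : 3 / 2 ≤ Real.exp ((w : ℝ) / 2) := by
    linarith [Real.add_one_le_exp ((w : ℝ) / 2)]
  have h3 : Real.exp ((w : ℝ) / 4) ^ 2 = Real.exp (w / 2) := by
    rw [← Real.exp_nat_mul]; congr 1; push_cast; ring
  have h4 : Real.exp (-(w : ℝ)) * (Real.exp (w / 2) * Real.exp (w / 2)) = 1 := by
    rw [← Real.exp_add, ← Real.exp_add]; ring_nf; exact Real.exp_zero
  refine (sq_le_sq₀ (Real.exp_pos _).le (Nat.cast_nonneg q)).1 ?_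
  rw [h3]
  have h5 := Real.exp_pos ((w : ℝ) / 2)
  have h6 : Real.exp ((w : ℝ) / 2) * Real.exp (w / 2) * (2 / 3) ≤ (q : ℝ) ^ 2 := by
    calc _ ≤ Real.exp ((w : ℝ) / 2) * Real.exp (w / 2) * ((q : ℝ) ^ 2 * Real.exp (-w)) := by
          gcongr
      _ = (q : ℝ) ^ 2 * (Real.exp (-w) * (Real.exp (w / 2) * Real.exp (w / 2))) := by ring
      _ = _ := by rw [h4, mul_one]
  nlinarith

end LowerBound

theorem mainTheorem2 :
    ∃ ε₀ : ℝ, 0 < ε₀ ∧ ∃ c : ℝ, 0 < c ∧ ∃ n₀ : ℕ, ∀ n : ℕ, n₀ ≤ n →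
      ∀ ε : ℝ, 0 < ε → ε ≤ ε₀ → ∀ (T : NonAdaptiveAlg n) (q : ℕ),
        T.MakesAtMost q → T.IsOneSidedTester 2 ⌊(n : ℝ) ^ (0.01 : ℝ)⌋₊ ε →
          Real.exp (c * (n : ℝ) ^ (0.48 : ℝ)) ≤ (q : ℝ) := by
  -- `2 ^ 18` ensures `n ^ 0.48 ≥ 256`, hence `w ≥ 1`; `2048 = 4 * 512` combines `exp (w / 4)` with
  -- `n ^ 0.48 ≤ 512 * w`.
  refine ⟨1 / 4000, by norm_num, 1 / 2048, by norm_num, 2 ^ 18, ?_⟩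
  intro n hn ε _ hε T q hq hT
  have hn' : ((2 : ℝ) ^ (18 : ℕ)) ≤ n := by exact_mod_cast hn
  have hn0 : (0 : ℝ) < n := lt_of_lt_of_le (by positivity) hn'
  have hn1 : (1 : ℝ) ≤ n := le_trans (by norm_num) hn'
  obtain ⟨ℓ, hℓdef⟩ : ∃ ℓ, ℓ = ⌊(n : ℝ) ^ (0.01 : ℝ)⌋₊ := ⟨_, rfl⟩
  rw [← hℓdef] at hT
  have hℓ : 0 < ℓ := by
    rw [hℓdef, Nat.floor_pos]
    exact Real.one_le_rpow hn1 (by norm_num)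
  have hℓ2 : (ℓ : ℝ) ^ 2 ≤ (n : ℝ) ^ (0.02 : ℝ) := by
    have h1 : (ℓ : ℝ) ≤ (n : ℝ) ^ (0.01 : ℝ) := by
      rw [hℓdef]; exact Nat.floor_le (by positivity)
    calc (ℓ : ℝ) ^ 2 ≤ ((n : ℝ) ^ (0.01 : ℝ)) ^ 2 := by gcongr
      _ = _ := by rw [← Real.rpow_natCast, ← Real.rpow_mul hn0.le]; norm_num
  have hsplit : (n : ℝ) ^ (0.48 : ℝ) * (n : ℝ) ^ (0.02 : ℝ) = √n := by
    rw [← Real.rpow_add hn0, Real.sqrt_eq_rpow]; norm_num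
  have hbig : (256 : ℝ) ≤ (n : ℝ) ^ (0.48 : ℝ) := by
    calc (256 : ℝ) = ((2 : ℝ) ^ (18 : ℕ)) ^ (8 / 18 : ℝ) := by
          rw [← Real.rpow_natCast, ← Real.rpow_mul (by norm_num)]; norm_num
      _ ≤ (n : ℝ) ^ (8 / 18 : ℝ) := by gcongr
      _ ≤ _ := Real.rpow_le_rpow_of_exponent_le hn1 (by norm_num)
  obtain ⟨R, hR⟩ : ∃ R, R = n.sqrt := ⟨_, rfl⟩
  have hsqrt : √(n : ℝ) ≤ 2 * R := by
    have h1 : n < (R + 1) * (R + 1) := by rw [hR]; exact Nat.lt_succ_sqrt n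
    have h2 : 1 ≤ R := by by_contra! h; nlinarith
    have h3 : n ≤ (2 * R) ^ 2 := by nlinarith
    refine Real.sqrt_le_iff.2 ⟨by positivity, by exact_mod_cast h3⟩
  have h002 : (0 : ℝ) < (n : ℝ) ^ (0.02 : ℝ) := by positivity
  have hRℓ : 128 * ℓ ^ 2 ≤ R := by
    have : (128 * (ℓ : ℝ) ^ 2) ≤ R := by nlinarith
    exact_mod_cast this
  obtain ⟨w, hw⟩ : ∃ w, w = R / (128 * ℓ ^ 2) := ⟨_, rfl⟩
  have hℓp : 0 < 128 * ℓ ^ 2 := by positivity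
  have hw0 : 0 < w := by rw [hw]; exact Nat.div_pos hRℓ hℓp
  have hwR : 128 * w * ℓ ^ 2 ≤ R := by
    calc 128 * w * ℓ ^ 2 = R / (128 * ℓ ^ 2) * (128 * ℓ ^ 2) := by rw [hw]; ring
      _ ≤ R := Nat.div_mul_le_self _ _
  have hRw : R ≤ 256 * (ℓ ^ 2 * w) := by
    have h1 : R < (128 * ℓ ^ 2) * (w + 1) := by
      rw [hw]; exact Nat.lt_mul_div_succ R hℓp
    calc R ≤ (128 * ℓ ^ 2) * (w + 1) := h1.le
      _ ≤ (128 * ℓ ^ 2) * (w + w) := by gcongr; omega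
      _ = _ := by ring
  have hfin : (n : ℝ) ^ (0.48 : ℝ) ≤ 512 * w := by
    refine le_of_mul_le_mul_right ?_ h002
    have h1 : (R : ℝ) ≤ 256 * (ℓ ^ 2 * w) := by exact_mod_cast hRw
    calc (n : ℝ) ^ (0.48 : ℝ) * (n : ℝ) ^ (0.02 : ℝ) ≤ 2 * R := hsplit ▸ hsqrt
      _ ≤ 512 * w * (ℓ : ℝ) ^ 2 := by linarith
      _ ≤ _ := by gcongr
  refine le_trans (Real.exp_le_exp.2 ?_)
    (exp_le_queries_of_isOneSidedTester (le_trans (by norm_num) hn) hℓ hw0 hR hwR hε hq hT)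
  linarith
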